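/- Let $d\ge 1$, $1\le p<\infty$, and let $(\nu_\varepsilon)_{\varepsilon>0}$ be a family of measurable functions $\nu_\varepsilon:\mathbb{R}^d\setminus\{0\}\to[0,\infty]$ such that, for every $\varepsilon>0$ and every $\delta>0$, $\nu_\varepsilon$ is radial, \[ \int_{\mathbb{R}^d}(1\wedge|h|^p)\,\nu_\varepsilon(h)\,dh=1 \qquad\text{and}\qquad \lim_{\varepsilon\to0^+}\int_{|h|>\delta}(1\wedge|h|^p)\,\nu_\varepsilon(h)\,dh=0 . \] Let $\Omega\subset\mathbb{R}^d$ be an open set whose boundary is compact and Lipschitz, meaning that near each boundary point, after a rotation of the coordinates, $\Omega$ is the region strictly above the graph of a Lipschitz function of $d-1$ variables. Write $\Omega^c=\mathbb{R}^d\setminus\Omega$. Let $u\in W^{1,p}(\mathbb{R}^d)$ be real-valued with distributional gradient $\nabla u$. Then \[ \lim_{\varepsilon\to0^+}\iint_{\Omega\times\Omega^c}|u(x)-u(y)|^p\,\nu_\varepsilon(x-y)\,dx\,dy=0, \] and consequently \[ \lim_{\varepsilon\to0^+}\iint_{\Omega\times\mathbb{R}^d}|u(x)-u(y)|^p\,\nu_\varepsilon(x-y)\,dx\,dy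 =\lim_{\varepsilon\to0^+}\iint_{(\Omega^c\times\Omega^c)^c}|u(x)-u(y)|^p\,\nu_\varepsilon(x-y)\,dx\,dy =K_{d,p}\int_\Omega|\nabla u(x)|^p\,dx , \] where $(\Omega^c\times\Omega^c)^c$ is the complement in $\mathbb{R}^d\times\mathbb{R}^d$ and, for any unit vector $e\in\mathbb{R}^d$, \[ K_{d,p}=\frac{1}{\sigma(\mathbb{S}^{d-1})}\int_{\mathbb{S}^{d-1}}|w\cdot e|^p\,d\sigma(w) \] with $\sigma$ the surface measure on the unit sphere $\mathbb{S}^{d-1}$ (the value does not depend on $e$). -/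

import Mathlib

open MeasureTheory Filter Topology Set
open scoped ENNReal NNReal

noncomputable section

namespace NonlocalCollapse

/-- `ν ε`, `ε > 0`, is a Dirac approximation of `p`-Lévy measures on `ℝ^d`: each `ν ε` is a
(Lebesgue) measurable radial function with values in `[0, ∞]`,
`∫ (1 ∧ |h|^p) ν_ε(h) dh = 1`, and `∫_{|h| > δ} (1 ∧ |h|^p) ν_ε(h) dh → 0` as `ε → 0⁺` for every
`δ > 0`. The value of `ν ε` at the origin plays no role. -/
structure IsDiracApprox {d : ℕ} (p : ℝ) (ν : ℝ → EuclideanSpace ℝ (Fin d) → ℝ≥0∞) : Prop where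
  aemeasurable : ∀ ε : ℝ, 0 < ε → AEMeasurable (ν ε) volume
  radial : ∀ ε : ℝ, 0 < ε → ∀ h k : EuclideanSpace ℝ (Fin d), ‖h‖ = ‖k‖ → ν ε h = ν ε k
  integral_eq_one : ∀ ε : ℝ, 0 < ε → ∫⁻ h, ENNReal.ofReal (min 1 (‖h‖ ^ p)) * ν ε h = 1
  concentration : ∀ δ : ℝ, 0 < δ →
    Tendsto (fun ε : ℝ =>
        ∫⁻ h in {h : EuclideanSpace ℝ (Fin d) | δ < ‖h‖},
          ENNReal.ofReal (min 1 (‖h‖ ^ p)) * ν ε h)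
      (𝓝[>] 0) (𝓝 0)

/-- The nonlocal energy `∬_S |u(x) - u(y)|^p ν(x - y) dx dy` over `S ⊆ ℝ^d × ℝ^d`. -/
def nonlocalEnergy {d : ℕ} (p : ℝ) (ν : EuclideanSpace ℝ (Fin d) → ℝ≥0∞)
    (u : EuclideanSpace ℝ (Fin d) → ℝ)
    (S : Set (EuclideanSpace ℝ (Fin d) × EuclideanSpace ℝ (Fin d))) : ℝ≥0∞ :=
  ∫⁻ z in S, ‖u z.1 - u z.2‖ₑ ^ p * ν (z.1 - z.2)

/-- `g` is the distributional gradient of `u` on `Ω`. -/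
structure HasWeakGradient {d : ℕ} (Ω : Set (EuclideanSpace ℝ (Fin d)))
    (u : EuclideanSpace ℝ (Fin d) → ℝ)
    (g : EuclideanSpace ℝ (Fin d) → EuclideanSpace ℝ (Fin d)) : Prop where
  locallyIntegrableOn_fun : LocallyIntegrableOn u Ω volume
  locallyIntegrableOn_grad : LocallyIntegrableOn g Ω volume
  integral_eq : ∀ φ : EuclideanSpace ℝ (Fin d) → ℝ,
    ContDiff ℝ ((⊤ : ℕ∞) : WithTop ℕ∞) φ → HasCompactSupport φ → tsupport φ ⊆ Ω →
    ∀ i : Fin d,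
      ∫ x in Ω, u x * fderiv ℝ φ x (EuclideanSpace.single i 1) = - ∫ x in Ω, φ x * g x i

/-- `u ∈ W^{1,p}(Ω)`. -/
def MemW1p {d : ℕ} (Ω : Set (EuclideanSpace ℝ (Fin d))) (p : ℝ)
    (u : EuclideanSpace ℝ (Fin d) → ℝ) : Prop :=
  MemLp u (ENNReal.ofReal p) (volume.restrict Ω) ∧
    ∃ g : EuclideanSpace ℝ (Fin d) → EuclideanSpace ℝ (Fin d),
      HasWeakGradient Ω u g ∧ MemLp g (ENNReal.ofReal p) (volume.restrict Ω)

/-- The boundary of `Ω` is Lipschitz: near each boundary point `z`, in a suitable direction `n`,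
`Ω` is the region strictly above the graph of a Lipschitz function `γ` on the hyperplane
orthogonal to `n`. -/
def HasLipschitzBoundary {d : ℕ} (Ω : Set (EuclideanSpace ℝ (Fin d))) : Prop :=
  ∀ z ∈ frontier Ω, ∃ r : ℝ, 0 < r ∧
    ∃ n : EuclideanSpace ℝ (Fin d), ‖n‖ = 1 ∧
    ∃ (L : ℝ≥0) (γ : ((Submodule.span ℝ {n})ᗮ : Submodule ℝ (EuclideanSpace ℝ (Fin d))) → ℝ),
      LipschitzWith L γ ∧
      ∀ x ∈ Metric.ball z r,
        x ∈ Ω ↔ γ ((Submodule.span ℝ {n})ᗮ.orthogonalProjectionOnto x) < inner ℝ n x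

/-- The mean value `⨍ |w · e|^p dσ(w)` over the unit sphere of `ℝ^d`, `σ` the surface measure. For
a unit vector `e` this is the constant `K_{d,p}`. -/
def sphereMean {d : ℕ} (p : ℝ) (e : EuclideanSpace ℝ (Fin d)) : ℝ :=
  ⨍ w : Metric.sphere (0 : EuclideanSpace ℝ (Fin d)) 1,
    |inner ℝ (w : EuclideanSpace ℝ (Fin d)) e| ^ p
      ∂((volume : Measure (EuclideanSpace ℝ (Fin d))).toSphere)

end NonlocalCollapse

end

namespace NonlocalCollapse

/-! Everything rests on one limit: for an arbitrary set A, the energy over A × ℝ^d tends to K_{d,p}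
∫_A |∇u|^p (`tendsto_nonlocalEnergy_prod_univ`). Put y = x + h. For almost every x the increment of
u is ∫_0^1 ∇u(x + th)·h dt (`ae_sub_eq_integral_segment`), so replacing it by ∇u(x)·h costs, in
L^p(dx), at most |h| times the L^p modulus of continuity of ∇u (`lintegral_taylor_le`). Minkowski's
inequality on A × {|h| ≤ δ} with the measure dx ν_ε(h)dh turns this into a two-sided bound between
p-th roots of energies (`nonlocal_local_comparison`). The linearised energy is computed exactly: by
polar coordinates and invariance under reflections it equals K_{d,p} ∫_A |∇u|^p times ∫_{|h| ≤ δ}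
|h|^p ν_ε(h)dh, and this moment tends to 1. Pairs at distance more than δ contribute at most a
constant times ‖u‖_p^p times the tail mass of ν_ε, which vanishes.

The freedom in A yields the cross term. If x ∈ Ω and y ∉ Ω are at distance at most δ, then x lies
within δ of the frontier, so the cross energy is at most the energy over (δ-thickened frontier) ×
ℝ^d plus that of far pairs. As ε → 0 the bound becomes K_{d,p} times the integral of |∇u|^p over the
thickening, which is small for small δ because a Lipschitz boundary is Lebesgue-null. Finally, the
complement of Ω^c × Ω^c is Ω × ℝ^d together with Ω^c × Ω, and by symmetry the latter carries the
cross energy. -/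

theorem setLIntegral_closedBall_translate_le {E : Type*} [NormedAddCommGroup E]
    [MeasurableSpace E] [BorelSpace E] {μ : Measure E} [μ.IsAddRightInvariant] (f : E → ℝ≥0∞) {R S : ℝ}
    {k : E} (hk : ‖k‖ ≤ S) :
    ∫⁻ x in Metric.closedBall 0 R, f (x + k) ∂μ ≤ ∫⁻ x in Metric.closedBall 0 (R + S), f x ∂μ := by
  rw [← lintegral_indicator measurableSet_closedBall,
    ← lintegral_indicator measurableSet_closedBall,
    ← lintegral_add_right_eq_self ((Metric.closedBall (0 : E) (R + S)).indicator f) k]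
  refine lintegral_mono fun x => ?_
  by_cases hx : x ∈ Metric.closedBall (0 : E) R
  · have hx' : x + k ∈ Metric.closedBall (0 : E) (R + S) := by
      rw [mem_closedBall_zero_iff] at hx ⊢
      exact (norm_add_le _ _).trans (by gcongr)
    rw [indicator_of_mem hx, indicator_of_mem hx']
  · rw [indicator_of_notMem hx]
    exact zero_le

/-! ### Increments of a Sobolev function as integrals along segments. -/

section Translates

variable {E : Type*} [NormedAddCommGroup E] [InnerProductSpace ℝ E] [FiniteDimensional ℝ E]
  [MeasurableSpace E] [BorelSpace E] {μ : Measure E} [μ.IsAddHaarMeasure]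

/-- For t ≤ 1 the shift by t • h keeps the ball of radius R inside the ball of radius R + ‖h‖, where
g is integrable, so Tonelli applies. This justifies the exchanges of integrals in the segment
formula. -/
theorem integrable_inner_segment {g : E → E} (hg : LocallyIntegrable g μ) (hgm : Measurable g)
    (h : E) (R : ℝ) :
    Integrable (fun z : E × ℝ => inner ℝ (g (z.1 + z.2 • h)) h)
      ((μ.restrict (Metric.closedBall 0 R)).prod (volume.restrict (Ioc (0 : ℝ) 1))) := by
  have hm : Measurable fun z : E × ℝ => g (z.1 + z.2 • h) := by fun_prop
  have key : Integrable (fun z : E × ℝ => g (z.1 + z.2 • h))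
      ((μ.restrict (Metric.closedBall 0 R)).prod (volume.restrict (Ioc (0 : ℝ) 1))) := by
    refine ⟨hm.aestronglyMeasurable, ?_⟩
    rw [HasFiniteIntegral, lintegral_prod_symm' _ hm.enorm]
    have hfin : ∫⁻ x in Metric.closedBall 0 (R + ‖h‖), ‖g x‖ₑ ∂μ < ∞ :=
      (hg.integrableOn_isCompact (isCompact_closedBall 0 (R + ‖h‖))).2
    calc _ ≤ ∫⁻ t in Ioc (0 : ℝ) 1, ∫⁻ x in Metric.closedBall 0 (R + ‖h‖), ‖g x‖ₑ ∂μ := by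
          refine setLIntegral_mono' measurableSet_Ioc fun t ht => ?_
          refine setLIntegral_closedBall_translate_le (μ := μ) (fun x => ‖g x‖ₑ) (k := t • h) ?_
          rw [norm_smul, Real.norm_of_nonneg ht.1.le]
          exact mul_le_of_le_one_left (norm_nonneg _) ht.2
      _ < ∞ := by simpa using hfin
  exact key.inner_const h

theorem ae_integrable_inner_segment {g : E → E} (hg : LocallyIntegrable g μ) (hgm : Measurable g)
    (h : E) :
    ∀ᵐ x ∂μ, Integrable (fun t : ℝ => inner ℝ (g (x + t • h)) h)
      (volume.restrict (Ioc (0 : ℝ) 1)) := by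
  have : ∀ n : ℕ, ∀ᵐ x ∂μ, x ∈ Metric.closedBall (0 : E) n →
      Integrable (fun t : ℝ => inner ℝ (g (x + t • h)) h) (volume.restrict (Ioc (0 : ℝ) 1)) :=
    fun n => (ae_restrict_iff' measurableSet_closedBall).1
      (integrable_inner_segment hg hgm h n).prod_right_ae
  filter_upwards [ae_all_iff.2 this] with x hx
  obtain ⟨n, hn⟩ := exists_nat_ge ‖x‖
  exact hx n (by simpa using hn)

theorem locallyIntegrable_integral_inner_segment {g : E → E} (hg : LocallyIntegrable g μ)
    (hgm : Measurable g) (h : E) :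
    LocallyIntegrable (fun x => ∫ t in Ioc (0 : ℝ) 1, inner ℝ (g (x + t • h)) h) μ := by
  intro x
  refine ⟨Metric.closedBall 0 (‖x‖ + 1), ?_, ?_⟩
  · exact mem_of_superset (Metric.isOpen_ball.mem_nhds (by simp)) Metric.ball_subset_closedBall
  · exact (integrable_inner_segment hg hgm h _).integral_prod_left

/-- If `⟨g, v⟩` is the distributional derivative of `u` in every direction `v`, then the increments
of `u` are the integrals of `g` along segments, almost everywhere. -/
theorem ae_sub_eq_integral_segment {u : E → ℝ} {g : E → E} (hu : LocallyIntegrable u μ)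
    (hg : LocallyIntegrable g μ) (hgm : Measurable g)
    (hw : ∀ φ : E → ℝ, ContDiff ℝ ((⊤ : ℕ∞) : WithTop ℕ∞) φ → HasCompactSupport φ → ∀ v : E,
      ∫ x, u x * fderiv ℝ φ x v ∂μ = - ∫ x, φ x * inner ℝ (g x) v ∂μ) (h : E) :
    ∀ᵐ x ∂μ, u (x + h) - u x = ∫ t in Ioc (0 : ℝ) 1, inner ℝ (g (x + t • h)) h := by
  have huh : LocallyIntegrable (fun x => u (x + h)) μ := by
    intro x
    obtain ⟨s, hs, hi⟩ := hu (x + h)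
    refine ⟨(· + h) ⁻¹' s, (continuous_add_const h).continuousAt hs, ?_⟩
    exact ((measurePreserving_add_right μ h).integrableOn_comp_preimage
      (measurableEmbedding_addRight h)).2 hi
  -- Both sides are locally integrable, so it suffices to test against smooth φ. The increment is
  -- moved onto φ, where the fundamental theorem of calculus is available, and the weak derivative
  -- brings it back.
  refine ae_eq_of_integral_contDiff_smul_eq (huh.sub hu)
    (locallyIntegrable_integral_inner_segment hg hgm h) fun φ hφ hφc => ?_
  have hφ' : Continuous (fderiv ℝ φ) := hφ.continuous_fderiv (by simp)
  obtain ⟨R, hR⟩ := hφc.isCompact.isBounded.subset_closedBall (0 : E)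
  have hφ0 : ∀ x, x ∉ Metric.closedBall (0 : E) R → φ x = 0 := fun x hx =>
    image_eq_zero_of_notMem_tsupport fun h' => hx (hR h')
  have hφ'0 : ∀ x, x ∉ Metric.closedBall (0 : E) R → fderiv ℝ φ x = 0 := fun x hx =>
    image_eq_zero_of_notMem_tsupport fun h' => hx (hR (tsupport_fderiv_subset ℝ h'))
  obtain ⟨C, hC⟩ := hφ.continuous.bounded_above_of_compact_support hφc
  obtain ⟨C', hC'⟩ := hφ'.bounded_above_of_compact_support (hφc.fderiv (𝕜 := ℝ))
  have hshift : ∀ k : E, HasCompactSupport fun x => φ (x - k) := fun k =>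
    hφc.comp_homeomorph (Homeomorph.subRight k)
  have hint : ∀ k : E, Integrable (fun x => φ (x - k) * u x) μ := fun k =>
    hu.integrable_smul_left_of_hasCompactSupport
      (hφ.continuous.comp (continuous_sub_right k)) (hshift k)
  have hftc : ∀ x, φ (x - h) - φ x = - ∫ t in Ioc (0 : ℝ) 1, fderiv ℝ φ (x - t • h) h := by
    intro x
    have hd : ∀ t ∈ uIcc (0 : ℝ) 1,
        HasDerivAt (fun t : ℝ => φ (x - t • h)) (fderiv ℝ φ (x - t • h) (-h)) t := by
      intro t _
      have h1 : HasDerivAt (fun t : ℝ => x - t • h) (-h) t := by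
        simpa using ((hasDerivAt_id t).smul_const h).const_sub x
      exact ((hφ.differentiable (by simp)) (x - t • h)).hasFDerivAt.comp_hasDerivAt t h1
    have := intervalIntegral.integral_eq_sub_of_hasDerivAt hd
      (Continuous.intervalIntegrable (by fun_prop) _ _)
    rw [intervalIntegral.integral_of_le zero_le_one] at this
    simp only [map_neg, one_smul, zero_smul, sub_zero] at this
    rw [← this, integral_neg]
  have hprod : Integrable (Function.uncurry fun (x : E) (t : ℝ) =>
      u x * fderiv ℝ φ (x - t • h) h) (μ.prod (volume.restrict (Ioc (0 : ℝ) 1))) := by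
    have h1 : Integrable ((Metric.closedBall (0 : E) (R + ‖h‖)).indicator u) μ :=
      (hu.integrableOn_isCompact (isCompact_closedBall 0 _)).integrable_indicator
        measurableSet_closedBall
    have h2 := (h1.comp_fst (volume.restrict (Ioc (0 : ℝ) 1))).bdd_mul
      (f := fun z : E × ℝ => fderiv ℝ φ (z.1 - z.2 • h) h) (c := C' * ‖h‖)
      (Continuous.aestronglyMeasurable (by fun_prop))
      (Eventually.of_forall fun z => (ContinuousLinearMap.le_opNorm _ _).trans (by gcongr; exact hC' _))
    refine h2.congr ?_
    have h3 : ∀ᵐ z ∂(μ.prod (volume.restrict (Ioc (0 : ℝ) 1))), z.2 ∈ Ioc (0 : ℝ) 1 :=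
      Measure.quasiMeasurePreserving_snd.ae (ae_restrict_mem measurableSet_Ioc)
    filter_upwards [h3] with z hz
    by_cases hx : z.1 ∈ Metric.closedBall (0 : E) (R + ‖h‖)
    · simp only [Function.uncurry, indicator_of_mem hx]
      ring
    · have : fderiv ℝ φ (z.1 - z.2 • h) = 0 := by
        refine hφ'0 _ fun hx' => hx ?_
        rw [mem_closedBall_zero_iff] at hx' ⊢
        have h4 : ‖z.2 • h‖ ≤ ‖h‖ := by
          rw [norm_smul, Real.norm_of_nonneg hz.1.le]
          exact mul_le_of_le_one_left (norm_nonneg _) hz.2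
        calc ‖z.1‖ = ‖(z.1 - z.2 • h) + z.2 • h‖ := by simp
          _ ≤ R + ‖h‖ := (norm_add_le _ _).trans (add_le_add hx' h4)
      simp [Function.uncurry, this]
  have hprod' : Integrable (Function.uncurry fun (x : E) (t : ℝ) =>
      φ x * inner ℝ (g (x + t • h)) h) (μ.prod (volume.restrict (Ioc (0 : ℝ) 1))) := by
    have h1 := (integrable_inner_segment hg hgm h R).bdd_mul (f := fun z => φ z.1) (c := C)
      (hφ.continuous.comp continuous_fst).aestronglyMeasurable (Eventually.of_forall fun z => hC _)
    rw [← Measure.restrict_univ (μ := volume.restrict (Ioc (0 : ℝ) 1)), Measure.prod_restrict] at h1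
    refine (integrableOn_iff_integrable_of_support_subset ?_).1 h1
    intro z hz
    refine ⟨?_, trivial⟩
    by_contra hx
    exact hz (by simp [Function.uncurry, hφ0 _ hx])
  -- For each fixed t, the weak derivative is tested against the translate of φ by t • h, and the
  -- translation is then undone by invariance of μ.
  have hinner : ∀ t : ℝ, ∫ x, u x * fderiv ℝ φ (x - t • h) h ∂μ =
      - ∫ x, φ x * inner ℝ (g (x + t • h)) h ∂μ := by
    intro t
    have h1 := hw (fun x => φ (x - t • h)) (hφ.comp (contDiff_id.sub contDiff_const))
      (hshift _) h
    simp only [fderiv_comp_sub] at h1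
    rw [h1, ← integral_add_right_eq_self _ (t • h)]
    simp
  calc ∫ x, φ x • (u (x + h) - u x) ∂μ
      = ∫ x, φ x * u (x + h) ∂μ - ∫ x, φ x * u x ∂μ := by
        simp only [smul_eq_mul, mul_sub]
        refine integral_sub ?_ ?_
        · exact huh.integrable_smul_left_of_hasCompactSupport hφ.continuous hφc
        · exact hu.integrable_smul_left_of_hasCompactSupport hφ.continuous hφc
    _ = ∫ x, φ (x - h) * u x ∂μ - ∫ x, φ x * u x ∂μ := by
        rw [← integral_add_right_eq_self (fun x => φ (x - h) * u x) h]
        simp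
    _ = ∫ x, u x * (φ (x - h) - φ x) ∂μ := by
        rw [← integral_sub (hint h) (by simpa using hint 0)]
        congr 1 with x
        ring
    _ = - ∫ x, (∫ t in Ioc (0 : ℝ) 1, u x * fderiv ℝ φ (x - t • h) h) ∂μ := by
        rw [← integral_neg]
        congr 1 with x
        rw [hftc, integral_const_mul]
        ring
    _ = ∫ x, (∫ t in Ioc (0 : ℝ) 1, φ x * inner ℝ (g (x + t • h)) h) ∂μ := by
        rw [integral_integral_swap hprod, integral_integral_swap hprod', ← integral_neg]
        congr 1 with t
        rw [hinner, neg_neg]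
    _ = _ := by
        congr 1 with x
        rw [integral_const_mul, smul_eq_mul]

end Translates

end NonlocalCollapse

namespace NonlocalCollapse

/-- Jensen's inequality, read off from the monotonicity of L^p norms in the exponent on a
probability space. It is applied to the segment parameter in (0, 1]. -/
theorem rpow_lintegral_le_lintegral_rpow {α : Type*} [MeasurableSpace α] {μ : Measure α}
    [IsProbabilityMeasure μ] {f : α → ℝ≥0∞} (hf : AEMeasurable f μ) {p : ℝ} (hp : 1 ≤ p) :
    (∫⁻ a, f a ∂μ) ^ p ≤ ∫⁻ a, f a ^ p ∂μ := by
  have hp0 : 0 < p := zero_lt_one.trans_le hp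
  have h1 : (1 : ℝ≥0∞) ≤ ENNReal.ofReal p := by simpa using hp
  have h := eLpNorm_le_eLpNorm_of_exponent_le h1 hf.aestronglyMeasurable
  rw [eLpNorm_one_eq_lintegral_enorm, eLpNorm_eq_lintegral_rpow_enorm_toReal
    (by simpa using hp0) ENNReal.ofReal_ne_top, ENNReal.toReal_ofReal hp0.le] at h
  simp only [enorm_eq_self] at h
  calc _ ≤ ((∫⁻ a, f a ^ p ∂μ) ^ (1 / p)) ^ p := by gcongr
    _ = _ := by rw [← ENNReal.rpow_mul, one_div_mul_cancel hp0.ne', ENNReal.rpow_one]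

/-! ### Taylor estimate and continuity of translations in L^p. -/

section Translates

variable {E : Type*} [NormedAddCommGroup E] [InnerProductSpace ℝ E] [FiniteDimensional ℝ E]
  [MeasurableSpace E] [BorelSpace E] {μ : Measure E} [μ.IsAddHaarMeasure]

/-- First-order Taylor estimate in `L^p`: the error is controlled by the `L^p` modulus of
continuity of the gradient. -/
theorem lintegral_taylor_le {u : E → ℝ} {g : E → E} (hu : LocallyIntegrable u μ)
    (hg : LocallyIntegrable g μ) (hgm : Measurable g)
    (hw : ∀ φ : E → ℝ, ContDiff ℝ ((⊤ : ℕ∞) : WithTop ℕ∞) φ → HasCompactSupport φ → ∀ v : E,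
      ∫ x, u x * fderiv ℝ φ x v ∂μ = - ∫ x, φ x * inner ℝ (g x) v ∂μ)
    {p : ℝ} (hp : 1 ≤ p) (h : E) {ω : ℝ≥0∞}
    (hω : ∀ k : E, ‖k‖ ≤ ‖h‖ → ∫⁻ x, ‖g (x + k) - g x‖ₑ ^ p ∂μ ≤ ω) :
    ∫⁻ x, ‖u (x + h) - u x - inner ℝ (g x) h‖ₑ ^ p ∂μ ≤ ‖h‖ₑ ^ p * ω := by
  have hp0 : 0 < p := zero_lt_one.trans_le hp
  have : IsProbabilityMeasure (volume.restrict (Ioc (0 : ℝ) 1)) := ⟨by simp⟩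
  have hm : Measurable fun z : E × ℝ => ‖h‖ₑ ^ p * ‖g (z.1 + z.2 • h) - g z.1‖ₑ ^ p := by fun_prop
  calc _ ≤ ∫⁻ x, (∫⁻ t in Ioc (0 : ℝ) 1, ‖h‖ₑ ^ p * ‖g (x + t • h) - g x‖ₑ ^ p) ∂μ := by
        refine lintegral_mono_ae ?_
        filter_upwards [ae_sub_eq_integral_segment hu hg hgm hw h,
          ae_integrable_inner_segment hg hgm h] with x hx hxi
        have h1 : u (x + h) - u x - inner ℝ (g x) h =
            ∫ t in Ioc (0 : ℝ) 1, inner ℝ (g (x + t • h) - g x) h := by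
          simp only [inner_sub_left]
          rw [integral_sub hxi (integrable_const _), hx]
          simp
        rw [h1]
        have hmx : Measurable fun t : ℝ => ‖h‖ₑ * ‖g (x + t • h) - g x‖ₑ := by fun_prop
        calc _ ≤ (∫⁻ t in Ioc (0 : ℝ) 1, ‖h‖ₑ * ‖g (x + t • h) - g x‖ₑ) ^ p := by
              gcongr
              refine (enorm_integral_le_lintegral_enorm _).trans (lintegral_mono fun t => ?_)
              rw [← ofReal_norm, ← ofReal_norm, ← ofReal_norm,
                ← ENNReal.ofReal_mul (norm_nonneg _), mul_comm]
              exact ENNReal.ofReal_le_ofReal (norm_inner_le_norm _ _)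
          _ ≤ _ := by
              refine (rpow_lintegral_le_lintegral_rpow hmx.aemeasurable hp).trans_eq ?_
              simp only [ENNReal.mul_rpow_of_nonneg _ _ hp0.le]
    _ = ∫⁻ t in Ioc (0 : ℝ) 1, (∫⁻ x, ‖h‖ₑ ^ p * ‖g (x + t • h) - g x‖ₑ ^ p ∂μ) :=
        lintegral_lintegral_swap hm.aemeasurable
    _ ≤ ∫⁻ t in Ioc (0 : ℝ) 1, ‖h‖ₑ ^ p * ω := by
        refine setLIntegral_mono' measurableSet_Ioc fun t ht => ?_
        rw [lintegral_const_mul _ (by fun_prop)]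
        gcongr
        refine hω _ ?_
        rw [norm_smul, Real.norm_of_nonneg ht.1.le]
        exact mul_le_of_le_one_left (norm_nonneg _) ht.2
    _ = _ := by simp

/-- Translations are continuous in `L^p`. -/
theorem exists_modulus_translate {F : Type*} [NormedAddCommGroup F] {g : E → F} {p : ℝ}
    (hp : 1 ≤ p) (hg : MemLp g (ENNReal.ofReal p) μ) {ω : ℝ≥0∞} (hω : 0 < ω) :
    ∃ δ > 0, ∀ k : E, ‖k‖ ≤ δ → ∫⁻ x, ‖g (x + k) - g x‖ₑ ^ p ∂μ ≤ ω := by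
  have hp0 : 0 < p := zero_lt_one.trans_le hp
  have : Fact (1 ≤ ENNReal.ofReal p) := ⟨by simpa using hp⟩
  have : Fact (ENNReal.ofReal p ≠ ∞) := ⟨ENNReal.ofReal_ne_top⟩
  -- The additive group acts continuously on L^p by translation of the argument; continuity at k = 0
  -- gives δ.
  have hc : Continuous fun k : E => DomAddAct.mk k +ᵥ hg.toLp g :=
    DomAddAct.continuous_mk.vadd continuous_const
  have hω' : 0 < ω ^ (1 / p) := ENNReal.rpow_pos_of_nonneg hω (by positivity)
  have h0 : DomAddAct.mk (0 : E) +ᵥ hg.toLp g = hg.toLp g := by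
    rw [DomAddAct.mk_zero, zero_vadd]
  have hev : ∀ᶠ k in 𝓝 (0 : E),
      DomAddAct.mk k +ᵥ hg.toLp g ∈ Metric.closedEBall (hg.toLp g) (ω ^ (1 / p)) := by
    refine hc.continuousAt ?_
    rw [h0]
    exact Metric.closedEBall_mem_nhds _ hω'
  obtain ⟨δ, hδ, hb⟩ := Metric.nhds_basis_closedBall.mem_iff.1 hev
  refine ⟨δ, hδ, fun k hk => ?_⟩
  have h1 := hb (mem_closedBall_zero_iff.2 hk)
  rw [mem_ofPred_eq, Metric.mem_closedEBall, DomAddAct.mk_vadd_toLp, Lp.edist_toLp_toLp,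
    eLpNorm_eq_lintegral_rpow_enorm_toReal (by simpa using hp0) ENNReal.ofReal_ne_top,
    ENNReal.toReal_ofReal hp0.le, ENNReal.rpow_le_rpow_iff (by positivity)] at h1
  refine le_trans (le_of_eq ?_) h1
  congr 1 with x
  simp [add_comm]

end Translates

/-! ### Polar coordinates for radial kernels. -/

section Radial

variable {E : Type*} [NormedAddCommGroup E] [InnerProductSpace ℝ E] [FiniteDimensional ℝ E]
  [MeasurableSpace E] [BorelSpace E] (μ : Measure E) [μ.IsAddHaarMeasure]

/-- Polar coordinates for the product of a radial function and a positively homogeneous one. -/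
theorem lintegral_radial_mul_homogeneous [Nontrivial E] {N : E → ℝ≥0∞} (hN : AEMeasurable N μ)
    (hrad : ∀ h k : E, ‖h‖ = ‖k‖ → N h = N k) {F : E → ℝ≥0∞} (hF : Measurable F)
    (hFtop : ∀ x, F x ≠ ∞) {p : ℝ}
    (hhom : ∀ (r : ℝ) (x : E), 0 < r → F (r • x) = ENNReal.ofReal r ^ p * F x)
    {e : E} (he : ‖e‖ = 1) :
    ∫⁻ h, F h * N h ∂μ = (∫⁻ w, F w ∂μ.toSphere) *
      ∫⁻ r : Ioi (0 : ℝ), ENNReal.ofReal (r : ℝ) ^ p * N ((r : ℝ) • e)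
        ∂(Measure.volumeIoiPow (Module.finrank ℝ E - 1)) := by
  set τ := Measure.volumeIoiPow (Module.finrank ℝ E - 1)
  have hmp := μ.measurePreserving_homeomorphUnitSphereProd
  have hemb := (homeomorphUnitSphereProd E).measurableEmbedding
  have hms : MeasurableSet ({0}ᶜ : Set E) := (measurableSet_singleton _).compl
  set f : E → ℝ≥0∞ := fun h => F h * N h with hf
  have hfm : AEMeasurable f μ := hF.aemeasurable.mul hN
  have hsymm := hmp.symm (homeomorphUnitSphereProd E).toMeasurableEquiv
  have hfm' : AEMeasurable (fun z => f ((homeomorphUnitSphereProd E).symm z))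
      (μ.toSphere.prod τ) := by
    have h1 : AEMeasurable (fun x : ({0}ᶜ : Set E) => f x) (μ.comap Subtype.val) := by
      have := (MeasurableEmbedding.subtype_coe hms).aemeasurable_map_iff (g := f)
        (μ := μ.comap Subtype.val)
      refine this.1 ?_
      rw [map_comap_subtype_coe hms]
      exact hfm.restrict
    exact h1.comp_quasiMeasurePreserving hsymm.quasiMeasurePreserving
  have hval : ∀ z : Metric.sphere (0 : E) 1 × Ioi (0 : ℝ),
      f ((homeomorphUnitSphereProd E).symm z) =
        F z.1 * (ENNReal.ofReal (z.2 : ℝ) ^ p * N ((z.2 : ℝ) • e)) := by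
    intro z
    have h1 : ‖(z.2 : ℝ) • (z.1 : E)‖ = ‖(z.2 : ℝ) • e‖ := by simp [norm_smul, he]
    simp only [hf, homeomorphUnitSphereProd_symm_apply_coe]
    rw [hhom _ _ z.2.2, hrad _ _ h1]
    ring
  calc ∫⁻ h, f h ∂μ = ∫⁻ h in {0}ᶜ, f h ∂μ := by rw [restrict_compl_singleton]
    _ = ∫⁻ x : ({0}ᶜ : Set E), f x ∂(μ.comap Subtype.val) := (lintegral_subtype_comap hms f).symm
    _ = ∫⁻ z, f ((homeomorphUnitSphereProd E).symm z) ∂(μ.toSphere.prod τ) := by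
        rw [← hmp.lintegral_comp_emb hemb]
        simp
    _ = ∫⁻ w, ∫⁻ r, f ((homeomorphUnitSphereProd E).symm (w, r)) ∂τ ∂μ.toSphere :=
        lintegral_prod _ hfm'
    _ = ∫⁻ w, F w * ∫⁻ r : Ioi (0 : ℝ), ENNReal.ofReal (r : ℝ) ^ p * N ((r : ℝ) • e) ∂τ
          ∂μ.toSphere := by
        congr 1 with w
        simp only [hval]
        -- The radial profile of N is not known to be measurable along the ray through e, so
        -- finiteness of F is used to pull out the constant.
        rw [lintegral_const_mul' _ _ (hFtop _)]
    _ = _ := lintegral_mul_const _ (hF.comp measurable_subtype_coe)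

end Radial

/-- A set which is a graph in the direction `n` is a null set. -/
theorem measure_graph_eq_zero {E : Type*} [NormedAddCommGroup E] [InnerProductSpace ℝ E]
    [FiniteDimensional ℝ E] [MeasurableSpace E] [BorelSpace E] (μ : Measure E)
    [μ.IsAddHaarMeasure] {n : E} (hn : ‖n‖ = 1) {γ : (Submodule.span ℝ {n})ᗮ → ℝ}
    (hγ : Continuous γ) :
    μ {x | γ ((Submodule.span ℝ {n})ᗮ.orthogonalProjectionOnto x) = inner ℝ n x} = 0 := by
  -- Each line parallel to n meets the graph exactly once, so the translates by n/(k+1) are pairwise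
  -- disjoint; infinitely many disjoint translates along a bounded sequence force measure zero.
  refine Measure.addHaar_eq_zero_of_disjoint_translates μ (fun k : ℕ => (1 / ((k : ℝ) + 1)) • n)
    ?_ ?_ ?_
  · refine (Metric.isBounded_closedBall (x := (0 : E)) (r := 1)).subset ?_
    rintro _ ⟨k, rfl⟩
    rw [mem_closedBall_zero_iff, norm_smul, hn, mul_one, Real.norm_of_nonneg (by positivity)]
    exact (div_le_one (by positivity)).2 (by simp)
  · intro i j hij
    rw [Function.onFun, Set.disjoint_left]
    rintro z hz hz'
    rw [singleton_add] at hz hz'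
    obtain ⟨x, hx, rfl⟩ := hz
    obtain ⟨y, hy, hxy⟩ := hz'
    have hPn : (Submodule.span ℝ {n})ᗮ.orthogonalProjectionOnto n = 0 := by
      apply Submodule.orthogonalProjectionOnto_orthogonal_apply_eq_zero
      exact Submodule.mem_span_singleton_self n
    have hP := congrArg ((Submodule.span ℝ {n})ᗮ.orthogonalProjectionOnto) hxy
    have hI := congrArg (fun x => inner ℝ n x) hxy
    simp only [map_add, map_smul, hPn, smul_zero, zero_add] at hP
    simp only [inner_add_right, inner_smul_right, real_inner_self_eq_norm_sq, hn] at hI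
    simp only [mem_ofPred_eq] at hx hy
    rw [← hx, ← hy, hP] at hI
    have h1 : 1 / ((j : ℝ) + 1) = 1 / ((i : ℝ) + 1) := by linarith
    apply hij
    rw [one_div, one_div, inv_inj] at h1
    exact_mod_cast (add_right_cancel h1).symm
  · exact (isClosed_eq (by fun_prop) (by fun_prop)).measurableSet

/-- Near a boundary point the frontier lies on the graph: its points are limits of points above the
graph, hence on or above it, and they are not in the open set Ω, hence not strictly above. -/
theorem volume_frontier_eq_zero {d : ℕ} {Ω : Set (EuclideanSpace ℝ (Fin d))} (hΩ : IsOpen Ω)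
    (hLip : HasLipschitzBoundary Ω) : volume (frontier Ω) = 0 := by
  refine measure_null_of_locally_null _ fun z hz => ?_
  obtain ⟨r, hr, n, hn, L, γ, hγ, hiff⟩ := hLip z hz
  refine ⟨Metric.ball z r ∩ frontier Ω,
    inter_mem (mem_nhdsWithin_of_mem_nhds (Metric.ball_mem_nhds z hr)) self_mem_nhdsWithin, ?_⟩
  refine measure_mono_null ?_ (measure_graph_eq_zero volume hn hγ.continuous)
  rintro x ⟨hxb, hx⟩
  have h1 : x ∉ Ω := fun h => by
    rw [hΩ.frontier_eq] at hx
    exact hx.2 h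
  have h2 : x ∈ closure (Ω ∩ Metric.ball z r) := by
    rw [inter_comm]
    exact Metric.isOpen_ball.inter_closure ⟨hxb, frontier_subset_closure hx⟩
  have h3 : IsClosed {x | γ ((Submodule.span ℝ {n})ᗮ.orthogonalProjectionOnto x) ≤ inner ℝ n x} :=
    isClosed_le (hγ.continuous.comp (by fun_prop)) (by fun_prop)
  have h4 := closure_minimal (fun y hy => ((hiff y hy.2).1 hy.1).le) h3 h2
  exact le_antisymm h4 (not_lt.1 fun h => h1 ((hiff x hxb).2 h))

end NonlocalCollapse

namespace NonlocalCollapse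

/-! ### Directional moments of radial kernels; testing the weak gradient. -/

section Kernel

variable {d : ℕ} {p : ℝ}

local notation "𝔼" => EuclideanSpace ℝ (Fin d)

/-- The reflection exchanging v and w preserves both Lebesgue measure and N. -/
theorem lintegral_inner_comp_isometry {N : 𝔼 → ℝ≥0∞} (hrad : ∀ h k : 𝔼, ‖h‖ = ‖k‖ → N h = N k)
    {v w : 𝔼} (hvw : ‖v‖ = ‖w‖) :
    ∫⁻ h, ‖inner ℝ v h‖ₑ ^ p * N h = ∫⁻ h, ‖inner ℝ w h‖ₑ ^ p * N h := by
  set R := (Submodule.span ℝ {v - w})ᗮ.reflection with hR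
  have hRv : R v = w := Submodule.reflection_sub hvw
  rw [← R.measurePreserving.lintegral_comp_emb R.toHomeomorph.measurableEmbedding
    (fun h => ‖inner ℝ w h‖ₑ ^ p * N h)]
  congr 1 with h
  rw [← hRv, R.inner_map_map, hrad (R h) h (R.norm_map h)]

theorem ofReal_sphereMean (hp : 0 ≤ p) (e : 𝔼) :
    ENNReal.ofReal (sphereMean p e) =
      (∫⁻ w : Metric.sphere (0 : 𝔼) 1, ‖inner ℝ e (w : 𝔼)‖ₑ ^ p ∂(volume : Measure 𝔼).toSphere) /
        (volume : Measure 𝔼).toSphere univ := by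
  have hc : Continuous fun w : Metric.sphere (0 : 𝔼) 1 => |inner ℝ (w : 𝔼) e| ^ p :=
    Continuous.rpow_const (by fun_prop) fun _ => Or.inr hp
  rw [sphereMean, average_eq, smul_eq_mul, ENNReal.ofReal_mul (by positivity),
    ofReal_integral_eq_lintegral_ofReal
      (hc.integrable_of_hasCompactSupport (HasCompactSupport.of_compactSpace _))
      (Eventually.of_forall fun w => by positivity), mul_comm, ENNReal.div_eq_inv_mul, mul_comm]
  by_cases h0 : (volume : Measure 𝔼).toSphere = 0
  · simp [h0]
  congr 1
  · rw [measureReal_def, ENNReal.ofReal_inv_of_pos, ENNReal.ofReal_toReal (measure_ne_top _ _)]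
    exact ENNReal.toReal_pos (by rwa [Ne, Measure.measure_univ_eq_zero]) (measure_ne_top _ _)
  · congr 1 with w
    rw [real_inner_comm, ← Real.norm_eq_abs, ← ENNReal.ofReal_rpow_of_nonneg (norm_nonneg _) hp,
      ofReal_norm]

/-- The `p`-th moment of a radial density in a direction. -/
theorem lintegral_inner_rpow_mul_radial (hp : 0 ≤ p) {N : 𝔼 → ℝ≥0∞} (hN : AEMeasurable N volume)
    (hrad : ∀ h k : 𝔼, ‖h‖ = ‖k‖ → N h = N k) {e : 𝔼} (he : ‖e‖ = 1) (v : 𝔼) :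
    ∫⁻ h, ‖inner ℝ v h‖ₑ ^ p * N h =
      ENNReal.ofReal (sphereMean p e) * ‖v‖ₑ ^ p * ∫⁻ h, ‖h‖ₑ ^ p * N h := by
  have : Nontrivial 𝔼 := ⟨⟨e, 0, fun h => by simp [h] at he⟩⟩
  have hσ : (volume : Measure 𝔼).toSphere univ ≠ 0 := by
    rw [Ne, Measure.measure_univ_eq_zero]
    exact Measure.toSphere_ne_zero _
  have h1 := lintegral_radial_mul_homogeneous volume hN hrad
    (F := fun h => ‖inner ℝ e h‖ₑ ^ p) (by fun_prop)
    (fun x => ENNReal.rpow_ne_top_of_nonneg hp enorm_ne_top) (p := p)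
    (fun r x hr => by
      rw [inner_smul_right, enorm_mul, ENNReal.mul_rpow_of_nonneg _ _ hp,
        Real.enorm_of_nonneg hr.le]) he
  -- The same radial factor appears for |e·h|^p and |h|^p, so the ratio of the two moments is a
  -- ratio of sphere integrals, namely the mean K_{d,p}.
  have h2 := lintegral_radial_mul_homogeneous volume hN hrad
    (F := fun h => ‖h‖ₑ ^ p) (by fun_prop)
    (fun x => ENNReal.rpow_ne_top_of_nonneg hp enorm_ne_top) (p := p)
    (fun r x hr => by
      rw [enorm_smul, ENNReal.mul_rpow_of_nonneg _ _ hp, Real.enorm_of_nonneg hr.le]) he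
  have h3 : ∀ w : Metric.sphere (0 : 𝔼) 1, ‖(w : 𝔼)‖ₑ = 1 := fun w => by
    rw [← ofReal_norm]
    simp
  simp only [h3, ENNReal.one_rpow, lintegral_const, one_mul] at h2
  have h4 : ∫⁻ h, ‖inner ℝ e h‖ₑ ^ p * N h =
      ENNReal.ofReal (sphereMean p e) * ∫⁻ h, ‖h‖ₑ ^ p * N h := by
    rw [h1, h2, ofReal_sphereMean hp, ← mul_assoc, ENNReal.div_mul_cancel hσ (measure_ne_top _ _)]
  rw [lintegral_inner_comp_isometry hrad (w := ‖v‖ • e) (by simp [norm_smul, he])]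
  have h5 : ∀ h : 𝔼, ‖inner ℝ (‖v‖ • e) h‖ₑ ^ p * N h =
      ‖v‖ₑ ^ p * (‖inner ℝ e h‖ₑ ^ p * N h) := fun h => by
    rw [real_inner_smul_left, enorm_mul, ENNReal.mul_rpow_of_nonneg _ _ hp, enorm_norm, mul_assoc]
  simp only [h5]
  rw [lintegral_const_mul' _ _ (ENNReal.rpow_ne_top_of_nonneg hp enorm_ne_top), h4]
  ring

end Kernel

/-- Uniqueness of the distributional gradient. -/
theorem HasWeakGradient.ae_eq {d : ℕ} {u : EuclideanSpace ℝ (Fin d) → ℝ}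
    {g g' : EuclideanSpace ℝ (Fin d) → EuclideanSpace ℝ (Fin d)}
    (hg : HasWeakGradient univ u g) (hg' : HasWeakGradient univ u g') : g =ᵐ[volume] g' := by
  have hloc : ∀ {f : EuclideanSpace ℝ (Fin d) → EuclideanSpace ℝ (Fin d)},
      LocallyIntegrableOn f univ volume → ∀ i : Fin d, LocallyIntegrable (fun x => f x i) := by
    intro f hf i x
    obtain ⟨s, hs, hi⟩ := locallyIntegrableOn_univ.1 hf x
    exact ⟨s, hs, (EuclideanSpace.proj (𝕜 := ℝ) i).integrable_comp hi⟩
  have h : ∀ i : Fin d, ∀ᵐ x, g x i = g' x i := by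
    intro i
    refine ae_eq_of_integral_contDiff_smul_eq (hloc hg.locallyIntegrableOn_grad i)
      (hloc hg'.locallyIntegrableOn_grad i) fun φ hφ hφc => ?_
    have h1 := hg.integral_eq φ hφ hφc (subset_univ _) i
    have h2 := hg'.integral_eq φ hφ hφc (subset_univ _) i
    rw [h1, neg_inj] at h2
    simpa only [Measure.restrict_univ, smul_eq_mul] using h2
  filter_upwards [ae_all_iff.2 h] with x hx
  ext i
  exact hx i

/-- The distributional gradient tests directional derivatives in every direction. -/
theorem HasWeakGradient.integral_inner_eq {d : ℕ} {u : EuclideanSpace ℝ (Fin d) → ℝ}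
    {g : EuclideanSpace ℝ (Fin d) → EuclideanSpace ℝ (Fin d)}
    (hg : HasWeakGradient univ u g) {φ : EuclideanSpace ℝ (Fin d) → ℝ}
    (hφ : ContDiff ℝ ((⊤ : ℕ∞) : WithTop ℕ∞) φ) (hφc : HasCompactSupport φ)
    (v : EuclideanSpace ℝ (Fin d)) :
    ∫ x, u x * fderiv ℝ φ x v = - ∫ x, φ x * inner ℝ (g x) v := by
  have hu := locallyIntegrableOn_univ.1 hg.locallyIntegrableOn_fun
  have hgl := locallyIntegrableOn_univ.1 hg.locallyIntegrableOn_grad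
  have hφ' : Continuous (fderiv ℝ φ) := hφ.continuous_fderiv (by simp)
  have hv : v = ∑ i, v i • EuclideanSpace.single i (1 : ℝ) := by
    ext j
    simp [Finset.sum_apply, Pi.single_apply]
  have h1 : ∀ x, u x * fderiv ℝ φ x v =
      ∑ i, v i * (u x * fderiv ℝ φ x (EuclideanSpace.single i 1)) := by
    intro x
    conv_lhs => rw [hv]
    simp only [map_sum, map_smul, smul_eq_mul, Finset.mul_sum]
    exact Finset.sum_congr rfl fun i _ => by ring
  have h2 : ∀ x, φ x * inner ℝ (g x) v = ∑ i, v i * (φ x * g x i) := by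
    intro x
    rw [PiLp.inner_apply, Finset.mul_sum]
    exact Finset.sum_congr rfl fun i _ => by simp; ring
  simp only [h1, h2]
  rw [integral_finsetSum, integral_finsetSum, ← Finset.sum_neg_distrib]
  · refine Finset.sum_congr rfl fun i _ => ?_
    have := hg.integral_eq φ hφ hφc (subset_univ _) i
    simp only [Measure.restrict_univ] at this
    rw [integral_const_mul, integral_const_mul, this, mul_neg]
  · intro i _
    refine Integrable.const_mul ?_ _
    exact (EuclideanSpace.proj (𝕜 := ℝ) i).integrable_comp
      (hgl.integrable_smul_left_of_hasCompactSupport hφ.continuous hφc)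
  · intro i _
    refine Integrable.const_mul ?_ _
    simp only [mul_comm (u _)]
    refine hu.integrable_smul_left_of_hasCompactSupport
      (g := fun x => fderiv ℝ φ x (EuclideanSpace.single i 1)) (by fun_prop) ?_
    exact (hφc.fderiv (𝕜 := ℝ)).comp_left (g := fun L => L (EuclideanSpace.single i 1)) (by simp)

end NonlocalCollapse

namespace NonlocalCollapse

/-- Minkowski compares p-th roots, so convergence is proved for these and raised back to the power
p. The error η is fixed first; m and T may depend on it because the cutoff radius δ is chosen from
η. -/
theorem tendsto_of_rpow_le_add {ι : Type*} {l : Filter ι} {p : ℝ} (hp : 0 < p) {F : ι → ℝ≥0∞}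
    {L : ℝ≥0∞} (hL : L ≠ ∞)
    (h : ∀ η : ℝ≥0∞, 0 < η → ∃ m T : ι → ℝ≥0∞, Tendsto m l (𝓝 1) ∧ Tendsto T l (𝓝 0) ∧
      ∀ᶠ i in l, (L * m i) ^ (1 / p) ≤ F i ^ (1 / p) + η ∧
        F i ^ (1 / p) ≤ (L * m i) ^ (1 / p) + η + T i ^ (1 / p)) :
    Tendsto F l (𝓝 L) := by
  have hp' : 0 < 1 / p := by positivity
  have hLp : L ^ (1 / p) ≠ ∞ := ENNReal.rpow_ne_top_of_nonneg hp'.le hL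
  suffices H : Tendsto (fun i => F i ^ (1 / p)) l (𝓝 (L ^ (1 / p))) by
    have := (ENNReal.continuous_rpow_const (y := p)).continuousAt.tendsto.comp H
    simpa only [Function.comp_def, ← ENNReal.rpow_mul, one_div_mul_cancel hp.ne',
      ENNReal.rpow_one] using this
  rw [ENNReal.tendsto_nhds hLp]
  intro θ hθ
  have hη : 0 < θ / 3 := ENNReal.div_pos hθ.ne' (by simp)
  obtain ⟨m, T, hm, hT, hev⟩ := h (θ / 3) hη
  have hm' : Tendsto (fun i => (L * m i) ^ (1 / p)) l (𝓝 (L ^ (1 / p))) := by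
    have h1 : Tendsto (fun i => L * m i) l (𝓝 (L * 1)) :=
      ENNReal.Tendsto.const_mul hm (Or.inr hL)
    rw [mul_one] at h1
    exact h1.ennrpow_const _
  have hT' : Tendsto (fun i => T i ^ (1 / p)) l (𝓝 0) := by
    have h1 := hT.ennrpow_const (1 / p)
    rwa [ENNReal.zero_rpow_of_pos hp'] at h1
  have h3 : θ / 3 + θ / 3 + θ / 3 = θ := ENNReal.add_thirds θ
  filter_upwards [hev, (ENNReal.tendsto_nhds hLp).1 hm' _ hη,
    (ENNReal.tendsto_nhds_zero.1 hT') _ hη] with i ⟨h1, h2⟩ ⟨h4, h5⟩ h6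
  constructor
  · rw [tsub_le_iff_right] at h4 ⊢
    calc L ^ (1 / p) ≤ F i ^ (1 / p) + θ / 3 + θ / 3 := h4.trans (by gcongr)
      _ ≤ F i ^ (1 / p) + (θ / 3 + θ / 3 + θ / 3) := by
          rw [add_assoc]
          gcongr
          exact le_self_add
      _ = _ := by rw [h3]
  · calc F i ^ (1 / p) ≤ L ^ (1 / p) + θ / 3 + θ / 3 + θ / 3 := h2.trans (by gcongr)
      _ = L ^ (1 / p) + (θ / 3 + θ / 3 + θ / 3) := by ring
      _ = _ := by rw [h3]

/-! ### Comparison of nonlocal and linearised energies. -/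

section Energy

variable {d : ℕ} {p : ℝ}

local notation "𝔼" => EuclideanSpace ℝ (Fin d)

theorem nonlocalEnergy_congr_ae {ν : 𝔼 → ℝ≥0∞} {u u' : 𝔼 → ℝ} (h : u =ᵐ[volume] u')
    (S : Set (𝔼 × 𝔼)) : nonlocalEnergy p ν u S = nonlocalEnergy p ν u' S := by
  refine lintegral_congr_ae (ae_restrict_of_ae ?_)
  have h1 : ∀ᵐ z : 𝔼 × 𝔼, u z.1 = u' z.1 := Measure.quasiMeasurePreserving_fst.ae h
  have h2 : ∀ᵐ z : 𝔼 × 𝔼, u z.2 = u' z.2 := Measure.quasiMeasurePreserving_snd.ae h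
  filter_upwards [h1, h2] with z hz1 hz2
  rw [hz1, hz2]

theorem aemeasurable_energy_integrand {ν : 𝔼 → ℝ≥0∞} (hν : AEMeasurable ν volume) {u : 𝔼 → ℝ}
    (hu : Measurable u) :
    AEMeasurable (fun z : 𝔼 × 𝔼 => ‖u z.1 - u z.2‖ₑ ^ p * ν (z.1 - z.2)) volume := by
  refine AEMeasurable.mul (Measurable.aemeasurable (by fun_prop)) ?_
  exact hν.comp_quasiMeasurePreserving (quasiMeasurePreserving_sub volume volume)

/-- Substitution y = x + h, with radiality turning ν(-h) into ν(h). Absorbing ν into a measure makes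
the energy an L^p norm, ready for Minkowski. -/
theorem nonlocalEnergy_prod_univ {ν : 𝔼 → ℝ≥0∞} (hν : AEMeasurable ν volume)
    (hrad : ∀ h k : 𝔼, ‖h‖ = ‖k‖ → ν h = ν k) {u : 𝔼 → ℝ} (hu : Measurable u) (A : Set 𝔼) :
    nonlocalEnergy p ν u (A ×ˢ univ) =
      ∫⁻ x in A, ∫⁻ h, ‖u (x + h) - u x‖ₑ ^ p ∂(volume.withDensity ν) := by
  rw [nonlocalEnergy, Measure.volume_eq_prod, ← Measure.prod_restrict, Measure.restrict_univ,
    lintegral_prod]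
  · congr 1 with x
    rw [← lintegral_add_left_eq_self _ x, lintegral_withDensity_eq_lintegral_mul₀ hν
      (Measurable.aemeasurable (by fun_prop))]
    congr 1 with h
    rw [Pi.mul_apply, mul_comm, ← enorm_neg (u (x + h) - u x), neg_sub]
    congr 1
    exact hrad _ _ (by simp)
  · have := (aemeasurable_energy_integrand (p := p) hν hu).restrict (s := A ×ˢ univ)
    rwa [Measure.volume_eq_prod, ← Measure.prod_restrict, Measure.restrict_univ] at this

theorem lintegral_translate_sub_rpow_le (hp : 1 ≤ p) {u : 𝔼 → ℝ} (hu : Measurable u) (h : 𝔼) :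
    ∫⁻ x, ‖u (x + h) - u x‖ₑ ^ p ≤ 2 ^ (p - 1) * (2 * ∫⁻ x, ‖u x‖ₑ ^ p) := by
  calc _ ≤ ∫⁻ x, 2 ^ (p - 1) * (‖u (x + h)‖ₑ ^ p + ‖u x‖ₑ ^ p) := by
        refine lintegral_mono fun x => le_trans ?_ (ENNReal.rpow_add_le_mul_rpow_add_rpow _ _ hp)
        have := enorm_sub_le (a := u (x + h)) (b := u x)
        dsimp only
        gcongr
    _ = _ := by
        rw [lintegral_const_mul _ (by fun_prop), lintegral_add_left (by fun_prop),
          lintegral_add_right_eq_self (fun x => ‖u x‖ₑ ^ p) h, two_mul]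

/-- Quantitative comparison of the nonlocal energy on `A × ℝ^d` with the local energy on `A`. -/
theorem nonlocal_local_comparison (hp : 1 ≤ p) {ν : 𝔼 → ℝ≥0∞} (hν : AEMeasurable ν volume)
    (hrad : ∀ h k : 𝔼, ‖h‖ = ‖k‖ → ν h = ν k) {u : 𝔼 → ℝ} (hu : Measurable u) {g : 𝔼 → 𝔼}
    (hg : Measurable g) {e : 𝔼} (he : ‖e‖ = 1) (A : Set 𝔼) {δ : ℝ} {ω : ℝ≥0∞}
    (hω : ∀ h : 𝔼, ‖h‖ ≤ δ → ∫⁻ x, ‖u (x + h) - u x - inner ℝ (g x) h‖ₑ ^ p ≤ ‖h‖ₑ ^ p * ω) :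
    let m := ∫⁻ h in Metric.closedBall 0 δ, ‖h‖ₑ ^ p * ν h
    let L := ENNReal.ofReal (sphereMean p e) * ∫⁻ x in A, ‖g x‖ₑ ^ p
    (L * m) ^ (1 / p) ≤ nonlocalEnergy p ν u (A ×ˢ univ) ^ (1 / p) + (ω * m) ^ (1 / p) ∧
    nonlocalEnergy p ν u (A ×ˢ univ) ^ (1 / p) ≤ (L * m) ^ (1 / p) + (ω * m) ^ (1 / p) +
      (2 ^ (p - 1) * (2 * ∫⁻ x, ‖u x‖ₑ ^ p) *
        ∫⁻ h in (Metric.closedBall 0 δ)ᶜ, ν h) ^ (1 / p) := by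
  intro m L
  have hp0 : 0 < p := zero_lt_one.trans_le hp
  set B : Set 𝔼 := Metric.closedBall 0 δ with hB
  have hBm : MeasurableSet B := measurableSet_closedBall
  set μ : Measure 𝔼 := volume.withDensity ν with hμ
  set ρ := (volume.restrict A).prod (μ.restrict B) with hρ
  set f : 𝔼 × 𝔼 → ℝ≥0∞ := fun z => ‖u (z.1 + z.2) - u z.1‖ₑ with hf
  set k : 𝔼 × 𝔼 → ℝ≥0∞ := fun z => ‖inner ℝ (g z.1) z.2‖ₑ with hk
  set r : 𝔼 × 𝔼 → ℝ≥0∞ := fun z => ‖u (z.1 + z.2) - u z.1 - inner ℝ (g z.1) z.2‖ₑ with hr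
  have hfm : Measurable f := by fun_prop
  have hkm : Measurable k := by fun_prop
  have hrm : Measurable r := by fun_prop
  have hwd : ∀ (F : 𝔼 → ℝ≥0∞), Measurable F → ∀ s : Set 𝔼, MeasurableSet s →
      ∫⁻ h in s, F h ∂μ = ∫⁻ h in s, F h * ν h := by
    intro F hF s hs
    rw [hμ, restrict_withDensity hs, lintegral_withDensity_eq_lintegral_mul₀ hν.restrict
      hF.aemeasurable]
    simp only [Pi.mul_apply, mul_comm]
  have hind : ∀ F : 𝔼 → ℝ≥0∞, ∫⁻ h, F h * B.indicator ν h = ∫⁻ h in B, F h * ν h := by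
    intro F
    rw [← lintegral_indicator hBm]
    congr 1 with h
    by_cases hh : h ∈ B <;> simp [hh]
  -- The kernel truncated to a centred ball is still radial, so the directional moment formula
  -- applies for each x with v = g x.
  have hk_eq : ∫⁻ z, k z ^ p ∂ρ = L * m := by
    rw [hρ, lintegral_prod _ (by fun_prop)]
    have hx : ∀ x, ∫⁻ h, k (x, h) ^ p ∂(μ.restrict B) =
        (ENNReal.ofReal (sphereMean p e) * m) * ‖g x‖ₑ ^ p := by
      intro x
      have h1 := lintegral_inner_rpow_mul_radial hp0.le (hν.indicator hBm) (fun h k hhk => by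
        by_cases hh : h ∈ B
        · have hk' : k ∈ B := by simpa [hB, ← hhk] using hh
          rw [indicator_of_mem hh, indicator_of_mem hk', hrad _ _ hhk]
        · have hk' : k ∉ B := by simpa [hB, ← hhk] using hh
          rw [indicator_of_notMem hh, indicator_of_notMem hk']) he (g x)
      rw [hind, hind] at h1
      rw [hwd _ (by fun_prop) _ hBm, h1]
      ring
    simp only [hx]
    rw [lintegral_const_mul _ (by fun_prop)]
    ring
  have hr_le : ∫⁻ z, r z ^ p ∂ρ ≤ ω * m := by
    rw [hρ, lintegral_prod_symm' _ (by fun_prop)]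
    calc _ ≤ ∫⁻ h in B, ω * ‖h‖ₑ ^ p ∂μ := by
          refine setLIntegral_mono' hBm fun h hh => ?_
          rw [mul_comm]
          exact (setLIntegral_le_lintegral _ _).trans (hω h (by simpa [hB] using hh))
      _ = ω * m := by
          rw [lintegral_const_mul _ (by fun_prop), hwd _ (by fun_prop) _ hBm]
  have hF : nonlocalEnergy p ν u (A ×ˢ univ) = ∫⁻ z, f z ^ p ∂ρ +
      ∫⁻ z, f z ^ p ∂((volume.restrict A).prod (μ.restrict Bᶜ)) := by
    rw [nonlocalEnergy_prod_univ hν hrad hu, hρ, lintegral_prod _ (by fun_prop),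
      lintegral_prod _ (by fun_prop), ← lintegral_add_left]
    · congr 1 with x
      exact (lintegral_add_compl _ hBm).symm
    · exact Measurable.lintegral_prod_right' (f := fun z => f z ^ p) (by fun_prop)
  have htail : ∫⁻ z, f z ^ p ∂((volume.restrict A).prod (μ.restrict Bᶜ)) ≤
      2 ^ (p - 1) * (2 * ∫⁻ x, ‖u x‖ₑ ^ p) * ∫⁻ h in Bᶜ, ν h := by
    rw [lintegral_prod_symm' _ (by fun_prop)]
    calc _ ≤ ∫⁻ h in Bᶜ, 2 ^ (p - 1) * (2 * ∫⁻ x, ‖u x‖ₑ ^ p) ∂μ := by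
          refine lintegral_mono fun h => ?_
          exact (setLIntegral_le_lintegral _ _).trans (lintegral_translate_sub_rpow_le hp hu h)
      _ = _ := by
          rw [setLIntegral_const, hμ, withDensity_apply _ hBm.compl]
  have mink : ∀ a b c : 𝔼 × 𝔼 → ℝ≥0∞, Measurable b → Measurable c → (∀ z, a z ≤ b z + c z) →
      (∫⁻ z, a z ^ p ∂ρ) ^ (1 / p) ≤ (∫⁻ z, b z ^ p ∂ρ) ^ (1 / p) + (∫⁻ z, c z ^ p ∂ρ) ^ (1 / p) := by
    intro a b c hb hc habc
    refine le_trans ?_ (ENNReal.lintegral_Lp_add_le hb.aemeasurable hc.aemeasurable hp)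
    gcongr with z
    exact habc z
  constructor
  · rw [← hk_eq]
    refine (mink k f r hfm hrm fun z => ?_).trans ?_
    · have := enorm_sub_le (a := u (z.1 + z.2) - u z.1)
        (b := u (z.1 + z.2) - u z.1 - inner ℝ (g z.1) z.2)
      rwa [sub_sub_cancel] at this
    · gcongr
      rw [hF]
      exact le_self_add
  · rw [hF, ← hk_eq]
    -- Subadditivity of t ↦ t^(1/p), valid since 1/p ≤ 1, separates the tail before Minkowski is
    -- used on the ball.
    refine (ENNReal.rpow_add_le_add_rpow _ _ (by positivity)
      ((div_le_one hp0).2 hp)).trans ?_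
    gcongr
    refine (mink f k r hkm hrm fun z => ?_).trans ?_
    · have := enorm_add_le (inner ℝ (g z.1) z.2) (u (z.1 + z.2) - u z.1 - inner ℝ (g z.1) z.2)
      rwa [add_sub_cancel] at this
    · gcongr

end Energy

end NonlocalCollapse

namespace NonlocalCollapse

/-! ### Passage to the limit and the exchange across the boundary. -/

section Limit

variable {d : ℕ} {p : ℝ}

local notation "𝔼" => EuclideanSpace ℝ (Fin d)

theorem ofReal_min_one_rpow (hp : 0 ≤ p) {h : 𝔼} (hh : ‖h‖ ≤ 1) :
    ENNReal.ofReal (min 1 (‖h‖ ^ p)) = ‖h‖ₑ ^ p := by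
  rw [min_eq_right (Real.rpow_le_one (norm_nonneg _) hh hp),
    ← ENNReal.ofReal_rpow_of_nonneg (norm_nonneg _) hp, ofReal_norm]

theorem compl_closedBall_zero_eq (δ : ℝ) :
    (Metric.closedBall (0 : 𝔼) δ)ᶜ = {h : 𝔼 | δ < ‖h‖} := by
  ext h
  simp

/-- For δ ≤ 1 the weight 1 ∧ |h|^p is just |h|^p on the ball, so the normalisation splits into a
pure moment and a tail. -/
theorem IsDiracApprox.moment_add_tail {ν : ℝ → 𝔼 → ℝ≥0∞} (hν : IsDiracApprox p ν) (hp : 0 ≤ p)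
    {δ : ℝ} (hδ1 : δ ≤ 1) {ε : ℝ} (hε : 0 < ε) :
    (∫⁻ h in Metric.closedBall 0 δ, ‖h‖ₑ ^ p * ν ε h) +
      ∫⁻ h in {h : 𝔼 | δ < ‖h‖}, ENNReal.ofReal (min 1 (‖h‖ ^ p)) * ν ε h = 1 := by
  have hB : MeasurableSet (Metric.closedBall (0 : 𝔼) δ) := measurableSet_closedBall
  rw [← hν.integral_eq_one ε hε,
    ← lintegral_add_compl (μ := volume)
      (fun h : 𝔼 => ENNReal.ofReal (min 1 (‖h‖ ^ p)) * ν ε h) hB,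
    compl_closedBall_zero_eq]
  congr 1
  refine setLIntegral_congr_fun hB fun h hh => ?_
  have hh1 : ‖h‖ ≤ 1 := (mem_closedBall_zero_iff.1 hh).trans hδ1
  simp only [ofReal_min_one_rpow hp hh1]

theorem IsDiracApprox.tendsto_moment {ν : ℝ → 𝔼 → ℝ≥0∞} (hν : IsDiracApprox p ν) (hp : 0 ≤ p)
    {δ : ℝ} (hδ : 0 < δ) (hδ1 : δ ≤ 1) :
    Tendsto (fun ε => ∫⁻ h in Metric.closedBall 0 δ, ‖h‖ₑ ^ p * ν ε h) (𝓝[>] 0) (𝓝 1) := by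
  have h1 := ENNReal.Tendsto.sub (tendsto_const_nhds (x := (1 : ℝ≥0∞))) (hν.concentration δ hδ)
    (Or.inl ENNReal.one_ne_top)
  rw [tsub_zero] at h1
  refine h1.congr' ?_
  filter_upwards [self_mem_nhdsWithin] with ε hε
  have h2 := hν.moment_add_tail hp hδ1 hε
  refine (ENNReal.eq_sub_of_add_eq ?_ h2).symm
  exact ne_top_of_le_ne_top ENNReal.one_ne_top (le_add_self.trans_eq h2)

/-- Where |h| > δ the weight is at least δ^p, so the unweighted tail is at most δ^(-p) times the
weighted one. -/
theorem IsDiracApprox.tendsto_tail {ν : ℝ → 𝔼 → ℝ≥0∞} (hν : IsDiracApprox p ν) (hp : 0 ≤ p)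
    {δ : ℝ} (hδ : 0 < δ) (hδ1 : δ ≤ 1) :
    Tendsto (fun ε => ∫⁻ h in (Metric.closedBall 0 δ)ᶜ, ν ε h) (𝓝[>] 0) (𝓝 0) := by
  have hc : 0 < δ ^ p := Real.rpow_pos_of_pos hδ p
  have hc0 : ENNReal.ofReal (δ ^ p) ≠ 0 := by simpa using hc
  have h1 := ENNReal.Tendsto.const_mul (a := (ENNReal.ofReal (δ ^ p))⁻¹) (hν.concentration δ hδ)
    (Or.inr (ENNReal.inv_ne_top.2 hc0))
  rw [mul_zero] at h1
  refine tendsto_of_tendsto_of_tendsto_of_le_of_le tendsto_const_nhds h1 (fun _ => zero_le)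
    fun ε => ?_
  have hm : MeasurableSet {h : 𝔼 | δ < ‖h‖} := by
    rw [← compl_closedBall_zero_eq]
    exact measurableSet_closedBall.compl
  dsimp only
  rw [compl_closedBall_zero_eq, ← lintegral_const_mul' _ _ (ENNReal.inv_ne_top.2 hc0)]
  refine setLIntegral_mono' hm fun h hh => ?_
  have h2 : ENNReal.ofReal (δ ^ p) ≤ ENNReal.ofReal (min 1 (‖h‖ ^ p)) := by
    refine ENNReal.ofReal_le_ofReal (le_min (Real.rpow_le_one hδ.le hδ1 hp) ?_)
    exact Real.rpow_le_rpow hδ.le (le_of_lt hh) hp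
  calc ν ε h = (ENNReal.ofReal (δ ^ p))⁻¹ * (ENNReal.ofReal (δ ^ p) * ν ε h) := by
        rw [← mul_assoc, ENNReal.inv_mul_cancel hc0 ENNReal.ofReal_ne_top, one_mul]
    _ ≤ _ := by gcongr

theorem lintegral_enorm_rpow_ne_top {F : Type*} [NormedAddCommGroup F] {f : 𝔼 → F} (hp : 0 < p)
    (hf : MemLp f (ENNReal.ofReal p) volume) : ∫⁻ x, ‖f x‖ₑ ^ p ≠ ∞ := by
  have := lintegral_rpow_enorm_lt_top_of_eLpNorm_lt_top (by simpa using hp)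
    ENNReal.ofReal_ne_top hf.2
  rw [ENNReal.toReal_ofReal hp.le] at this
  exact this.ne

theorem HasWeakGradient.congr_ae {u u' : 𝔼 → ℝ} {g g' : 𝔼 → 𝔼} (h : HasWeakGradient univ u g)
    (hu : u =ᵐ[volume] u') (hg : g =ᵐ[volume] g') : HasWeakGradient univ u' g' where
  locallyIntegrableOn_fun := locallyIntegrableOn_univ.2
    ((locallyIntegrableOn_univ.1 h.locallyIntegrableOn_fun).congr hu)
  locallyIntegrableOn_grad := locallyIntegrableOn_univ.2
    ((locallyIntegrableOn_univ.1 h.locallyIntegrableOn_grad).congr hg)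
  integral_eq φ hφ hφc hφs i := by
    have h1 := h.integral_eq φ hφ hφc hφs i
    simp only [Measure.restrict_univ] at h1 ⊢
    have h2 : ∫ x, u' x * fderiv ℝ φ x (EuclideanSpace.single i 1) =
        ∫ x, u x * fderiv ℝ φ x (EuclideanSpace.single i 1) :=
      integral_congr_ae (by filter_upwards [hu] with x hx; rw [hx])
    have h3 : ∫ x, φ x * g' x i = ∫ x, φ x * g x i :=
      integral_congr_ae (by filter_upwards [hg] with x hx; rw [hx])
    rw [h2, h3, h1]

theorem tendsto_nonlocalEnergy_prod_univ_of_measurable (hp : 1 ≤ p) {ν : ℝ → 𝔼 → ℝ≥0∞}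
    (hν : IsDiracApprox p ν) {u : 𝔼 → ℝ} (hum : Measurable u)
    (hu : MemLp u (ENNReal.ofReal p) volume) {g : 𝔼 → 𝔼} (hgm : Measurable g)
    (hgp : MemLp g (ENNReal.ofReal p) volume) (hg : HasWeakGradient univ u g)
    {e : 𝔼} (he : ‖e‖ = 1) (A : Set 𝔼) :
    Tendsto (fun ε : ℝ => nonlocalEnergy p (ν ε) u (A ×ˢ univ)) (𝓝[>] 0)
      (𝓝 (ENNReal.ofReal (sphereMean p e) * ∫⁻ x in A, ‖g x‖ₑ ^ p)) := by
  have hp0 : 0 < p := zero_lt_one.trans_le hp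
  have hgfin : ∫⁻ x in A, ‖g x‖ₑ ^ p ≠ ∞ :=
    ne_top_of_le_ne_top (lintegral_enorm_rpow_ne_top hp0 hgp) (setLIntegral_le_lintegral _ _)
  refine tendsto_of_rpow_le_add hp0 (ENNReal.mul_ne_top ENNReal.ofReal_ne_top hgfin) fun η hη => ?_
  -- The modulus η^p makes the Minkowski error (η^p m)^(1/p) at most η, since the moment m is at
  -- most 1.
  obtain ⟨δ₀, hδ₀, hmod⟩ := exists_modulus_translate hp hgp (ω := η ^ p)
    (ENNReal.rpow_pos_of_nonneg hη hp0.le)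
  set δ := min δ₀ 1
  have hδ : 0 < δ := lt_min hδ₀ one_pos
  have hδ1 : δ ≤ 1 := min_le_right _ _
  have htaylor : ∀ h : 𝔼, ‖h‖ ≤ δ →
      ∫⁻ x, ‖u (x + h) - u x - inner ℝ (g x) h‖ₑ ^ p ≤ ‖h‖ₑ ^ p * η ^ p := fun h hh =>
    lintegral_taylor_le (locallyIntegrableOn_univ.1 hg.locallyIntegrableOn_fun)
      (locallyIntegrableOn_univ.1 hg.locallyIntegrableOn_grad) hgm
      (fun φ hφ hφc v => hg.integral_inner_eq hφ hφc v) hp h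
      fun k hk => hmod k (hk.trans (hh.trans (min_le_left _ _)))
  have hC : 2 ^ (p - 1) * (2 * ∫⁻ x, ‖u x‖ₑ ^ p) ≠ ∞ :=
    ENNReal.mul_ne_top (ENNReal.rpow_ne_top_of_nonneg (by linarith) (by simp))
      (ENNReal.mul_ne_top (by simp) (lintegral_enorm_rpow_ne_top hp0 hu))
  refine ⟨_, fun ε => 2 ^ (p - 1) * (2 * ∫⁻ x, ‖u x‖ₑ ^ p) *
    ∫⁻ h in (Metric.closedBall 0 δ)ᶜ, ν ε h, hν.tendsto_moment hp0.le hδ hδ1, ?_, ?_⟩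
  · simpa using ENNReal.Tendsto.const_mul (hν.tendsto_tail hp0.le hδ hδ1) (Or.inr hC)
  · filter_upwards [self_mem_nhdsWithin] with ε hε
    have hm : ∫⁻ h in Metric.closedBall 0 δ, ‖h‖ₑ ^ p * ν ε h ≤ 1 :=
      le_self_add.trans_eq (hν.moment_add_tail hp0.le hδ1 hε)
    have hle : (η ^ p * ∫⁻ h in Metric.closedBall 0 δ, ‖h‖ₑ ^ p * ν ε h) ^ (1 / p) ≤ η := by
      calc _ ≤ (η ^ p * 1) ^ (1 / p) := by gcongr
        _ = η := by rw [mul_one, ← ENNReal.rpow_mul, mul_one_div_cancel hp0.ne', ENNReal.rpow_one]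
    obtain ⟨h1, h2⟩ := nonlocal_local_comparison hp (hν.aemeasurable ε hε) (hν.radial ε hε) hum hgm
      he A htaylor
    exact ⟨h1.trans (by gcongr), h2.trans (by gcongr)⟩

/-- The nonlocal energy on `A × ℝ^d` converges to the local energy on `A`. -/
theorem tendsto_nonlocalEnergy_prod_univ (hp : 1 ≤ p) {ν : ℝ → 𝔼 → ℝ≥0∞}
    (hν : IsDiracApprox p ν) {u : 𝔼 → ℝ} (hu : MemLp u (ENNReal.ofReal p) volume) {g : 𝔼 → 𝔼}
    (hgp : MemLp g (ENNReal.ofReal p) volume) (hg : HasWeakGradient univ u g)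
    {e : 𝔼} (he : ‖e‖ = 1) (A : Set 𝔼) :
    Tendsto (fun ε : ℝ => nonlocalEnergy p (ν ε) u (A ×ˢ univ)) (𝓝[>] 0)
      (𝓝 (ENNReal.ofReal (sphereMean p e) * ∫⁻ x in A, ‖g x‖ₑ ^ p)) := by
  have hu' := hu.1.ae_eq_mk
  have hg' := hgp.1.ae_eq_mk
  have h := tendsto_nonlocalEnergy_prod_univ_of_measurable hp hν
    hu.1.stronglyMeasurable_mk.measurable (hu.ae_eq hu') hgp.1.stronglyMeasurable_mk.measurable
    (hgp.ae_eq hg') (hg.congr_ae hu' hg') he A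
  have h1 : ∫⁻ x in A, ‖g x‖ₑ ^ p = ∫⁻ x in A, ‖hgp.1.mk g x‖ₑ ^ p := by
    refine lintegral_congr_ae (ae_restrict_of_ae ?_)
    filter_upwards [hg'] with x hx
    rw [← hx]
  rw [h1]
  simpa only [nonlocalEnergy_congr_ae hu'] using h

theorem nonlocalEnergy_mono {ν : 𝔼 → ℝ≥0∞} {u : 𝔼 → ℝ} {S T : Set (𝔼 × 𝔼)} (h : S ⊆ T) :
    nonlocalEnergy p ν u S ≤ nonlocalEnergy p ν u T :=
  lintegral_mono_set h

theorem nonlocalEnergy_union_le {ν : 𝔼 → ℝ≥0∞} {u : 𝔼 → ℝ} (S T : Set (𝔼 × 𝔼)) :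
    nonlocalEnergy p ν u (S ∪ T) ≤ nonlocalEnergy p ν u S + nonlocalEnergy p ν u T :=
  lintegral_union_le _ _ _

theorem nonlocalEnergy_prod_comm {ν : 𝔼 → ℝ≥0∞} (hrad : ∀ h k : 𝔼, ‖h‖ = ‖k‖ → ν h = ν k)
    (u : 𝔼 → ℝ) (A B : Set 𝔼) :
    nonlocalEnergy p ν u (A ×ˢ B) = nonlocalEnergy p ν u (B ×ˢ A) := by
  have hs : MeasurePreserving (Prod.swap : 𝔼 × 𝔼 → 𝔼 × 𝔼) volume volume :=
    Measure.measurePreserving_swap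
  rw [nonlocalEnergy, nonlocalEnergy, ← hs.setLIntegral_comp_preimage_emb
    MeasurableEquiv.prodComm.measurableEmbedding _ (B ×ˢ A), preimage_swap_prod]
  congr 1 with z
  rw [Prod.fst_swap, Prod.snd_swap, ← enorm_neg (u z.1 - u z.2), neg_sub,
    hrad (z.1 - z.2) (z.2 - z.1) (norm_sub_rev _ _)]

/-- A segment from an open set to its complement meets the frontier. -/
theorem infEDist_frontier_le {Ω : Set 𝔼} (hΩ : IsOpen Ω) {x y : 𝔼} (hx : x ∈ Ω) (hy : y ∉ Ω) :
    Metric.infEDist x (frontier Ω) ≤ edist x y := by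
  obtain ⟨z, hz, hzf⟩ : (segment ℝ x y ∩ frontier Ω).Nonempty := by
    by_contra hne
    have hcov : ∀ w ∈ segment ℝ x y, w ∉ Ω → w ∉ closure Ω := fun w hw hwΩ hwc =>
      hne ⟨w, hw, by rw [hΩ.frontier_eq]; exact ⟨hwc, hwΩ⟩⟩
    obtain ⟨w, -, hw, hw'⟩ := (convex_segment (𝕜 := ℝ) x y).isPreconnected Ω (closure Ω)ᶜ hΩ
      isClosed_closure.isOpen_compl
      (fun w hw => or_iff_not_imp_left.2 (hcov w hw)) ⟨x, left_mem_segment ℝ x y, hx⟩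
      ⟨y, right_mem_segment ℝ x y, hcov y (right_mem_segment ℝ x y) hy⟩
    exact hw' (subset_closure hw)
  refine (Metric.infEDist_le_edist_of_mem hzf).trans ?_
  rw [edist_dist, edist_dist]
  refine ENNReal.ofReal_le_ofReal ?_
  have := dist_add_dist_of_mem_segment hz
  linarith [dist_nonneg (x := z) (y := y)]

/-- Restricting to far pairs amounts to truncating the kernel away from a ball, which keeps it
radial; each shift then costs at most a multiple of ‖u‖_p^p. -/
theorem nonlocalEnergy_far_le (hp : 1 ≤ p) {ν : 𝔼 → ℝ≥0∞} (hν : AEMeasurable ν volume)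
    (hrad : ∀ h k : 𝔼, ‖h‖ = ‖k‖ → ν h = ν k) {u : 𝔼 → ℝ} (hu : AEStronglyMeasurable u volume)
    (δ : ℝ) :
    nonlocalEnergy p ν u {z | z.1 - z.2 ∉ Metric.closedBall 0 δ} ≤
      2 ^ (p - 1) * (2 * ∫⁻ x, ‖u x‖ₑ ^ p) * ∫⁻ h in (Metric.closedBall 0 δ)ᶜ, ν h := by
  set B : Set 𝔼 := Metric.closedBall 0 δ with hB
  have hBm : MeasurableSet B := measurableSet_closedBall
  set v := hu.mk u
  have hv : Measurable v := hu.stronglyMeasurable_mk.measurable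
  have huv : u =ᵐ[volume] v := hu.ae_eq_mk
  have hint : ∫⁻ x, ‖u x‖ₑ ^ p = ∫⁻ x, ‖v x‖ₑ ^ p :=
    lintegral_congr_ae (by filter_upwards [huv] with x hx; rw [hx])
  set N : 𝔼 → ℝ≥0∞ := Bᶜ.indicator ν with hN
  have hNrad : ∀ h k : 𝔼, ‖h‖ = ‖k‖ → N h = N k := by
    intro h k hhk
    by_cases hh : h ∈ B
    · have hk : k ∈ B := by simpa [hB, ← hhk] using hh
      simp [hN, hh, hk]
    · have hk : k ∉ B := by simpa [hB, ← hhk] using hh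
      simp [hN, hh, hk, hrad _ _ hhk]
  have hset : MeasurableSet {z : 𝔼 × 𝔼 | z.1 - z.2 ∉ B} :=
    (measurable_fst.sub measurable_snd) hBm.compl
  rw [nonlocalEnergy_congr_ae huv, hint]
  calc nonlocalEnergy p ν v {z | z.1 - z.2 ∉ B} ≤ nonlocalEnergy p N v (univ ×ˢ univ) := by
        rw [univ_prod_univ]
        refine le_trans (le_of_eq ?_)
          (nonlocalEnergy_mono (subset_univ {z | z.1 - z.2 ∉ B}))
        refine setLIntegral_congr_fun hset fun z hz => ?_
        simp only [hN]
        rw [indicator_of_mem (show z.1 - z.2 ∈ Bᶜ from hz)]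
    _ = ∫⁻ x, ∫⁻ h, ‖v (x + h) - v x‖ₑ ^ p ∂(volume.withDensity N) := by
        rw [nonlocalEnergy_prod_univ (hν.indicator hBm.compl) hNrad hv, Measure.restrict_univ]
    _ = ∫⁻ h, (∫⁻ x, ‖v (x + h) - v x‖ₑ ^ p) ∂(volume.withDensity N) :=
        lintegral_lintegral_swap (Measurable.aemeasurable (by fun_prop))
    _ ≤ ∫⁻ _, 2 ^ (p - 1) * (2 * ∫⁻ x, ‖v x‖ₑ ^ p) ∂(volume.withDensity N) :=
        lintegral_mono fun h => lintegral_translate_sub_rpow_le hp hv h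
    _ = _ := by
        rw [lintegral_const, withDensity_apply _ MeasurableSet.univ, Measure.restrict_univ,
          lintegral_indicator hBm.compl]

/-- No energy is exchanged through a null frontier in the limit. -/
theorem tendsto_nonlocalEnergy_prod_compl (hp : 1 ≤ p) {ν : ℝ → 𝔼 → ℝ≥0∞}
    (hν : IsDiracApprox p ν) {u : 𝔼 → ℝ} (hu : MemLp u (ENNReal.ofReal p) volume) {g : 𝔼 → 𝔼}
    (hgp : MemLp g (ENNReal.ofReal p) volume) (hg : HasWeakGradient univ u g)
    {e : 𝔼} (he : ‖e‖ = 1) {Ω : Set 𝔼} (hΩ : IsOpen Ω) (hnull : volume (frontier Ω) = 0) :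
    Tendsto (fun ε : ℝ => nonlocalEnergy p (ν ε) u (Ω ×ˢ Ωᶜ)) (𝓝[>] 0) (𝓝 0) := by
  have hp0 : 0 < p := zero_lt_one.trans_le hp
  have hgfin := lintegral_enorm_rpow_ne_top hp0 hgp
  have hC : 2 ^ (p - 1) * (2 * ∫⁻ x, ‖u x‖ₑ ^ p) ≠ ∞ :=
    ENNReal.mul_ne_top (ENNReal.rpow_ne_top_of_nonneg (by linarith) (by simp))
      (ENNReal.mul_ne_top (by simp) (lintegral_enorm_rpow_ne_top hp0 hu))
  rw [ENNReal.tendsto_nhds_zero]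
  intro η hη
  have hη2 : 0 < η / 2 := ENNReal.half_pos hη.ne'
  have hthick : Tendsto (fun r => ENNReal.ofReal (sphereMean p e) *
      ∫⁻ x in Metric.cthickening r (frontier Ω), ‖g x‖ₑ ^ p) (𝓝[>] 0) (𝓝 0) := by
    -- The measure |g|^p dx is finite and absolutely continuous, so its mass on closed thickenings
    -- decreases to its mass on the null frontier.
    have h1 := tendsto_measure_cthickening_of_isClosed
      (μ := volume.withDensity fun x => ‖g x‖ₑ ^ p) (s := frontier Ω) ⟨1, one_pos, ?_⟩
      isClosed_frontier
    · rw [withDensity_absolutelyContinuous _ _ hnull] at h1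
      have h2 := ENNReal.Tendsto.const_mul (a := ENNReal.ofReal (sphereMean p e)) h1
        (Or.inr ENNReal.ofReal_ne_top)
      rw [mul_zero] at h2
      simp only [withDensity_apply _ Metric.isClosed_cthickening.measurableSet] at h2
      exact h2.mono_left nhdsWithin_le_nhds
    · rw [withDensity_apply _ Metric.isClosed_cthickening.measurableSet]
      exact ne_top_of_le_ne_top hgfin (setLIntegral_le_lintegral _ _)
  -- The radius δ is fixed before ε → 0: it makes the limiting energy on the thickening less than
  -- η/2, leaving η/2 for far pairs.
  obtain ⟨δ, hδη, hδ, hδ1⟩ := ((hthick.eventually_lt_const hη2).and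
    (Ioc_mem_nhdsGT (zero_lt_one' ℝ))).exists
  have hnear := (tendsto_nonlocalEnergy_prod_univ hp hν hu hgp hg he
    (Metric.cthickening δ (frontier Ω))).eventually_lt_const hδη
  have hfar := ENNReal.tendsto_nhds_zero.1 (by
    simpa using ENNReal.Tendsto.const_mul (hν.tendsto_tail hp0.le hδ hδ1) (Or.inr hC)) _ hη2
  filter_upwards [hnear, hfar, self_mem_nhdsWithin] with ε h1 h2 hε
  have hsub : Ω ×ˢ Ωᶜ ⊆ Metric.cthickening δ (frontier Ω) ×ˢ univ ∪
      {z : 𝔼 × 𝔼 | z.1 - z.2 ∉ Metric.closedBall 0 δ} := by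
    rintro ⟨x, y⟩ ⟨hx, hy⟩
    by_cases hxy : x - y ∈ Metric.closedBall (0 : 𝔼) δ
    · refine Or.inl ⟨(infEDist_frontier_le hΩ hx hy).trans ?_, trivial⟩
      rw [edist_dist, dist_eq_norm]
      exact ENNReal.ofReal_le_ofReal (mem_closedBall_zero_iff.1 hxy)
    · exact Or.inr hxy
  calc _ ≤ η / 2 + η / 2 := (nonlocalEnergy_mono hsub).trans ((nonlocalEnergy_union_le _ _).trans
        (add_le_add h1.le ((nonlocalEnergy_far_le hp (hν.aemeasurable ε hε) (hν.radial ε hε)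
          hu.1 δ).trans h2)))
    _ = η := ENNReal.add_halves η

end Limit

end NonlocalCollapse

theorem theorem1p5 {d : ℕ} {p : ℝ} (hp : 1 ≤ p)
    (ν : ℝ → EuclideanSpace ℝ (Fin d) → ℝ≥0∞) (hν : NonlocalCollapse.IsDiracApprox p ν)
    (Ω : Set (EuclideanSpace ℝ (Fin d))) (hΩ : IsOpen Ω)
    (hcomp : IsCompact (frontier Ω)) (hLip : NonlocalCollapse.HasLipschitzBoundary Ω)
    (u : EuclideanSpace ℝ (Fin d) → ℝ) (hu : NonlocalCollapse.MemW1p Set.univ p u)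
    (g : EuclideanSpace ℝ (Fin d) → EuclideanSpace ℝ (Fin d))
    (hg : NonlocalCollapse.HasWeakGradient Set.univ u g)
    (e : EuclideanSpace ℝ (Fin d)) (he : ‖e‖ = 1) :
    Tendsto (fun ε : ℝ => NonlocalCollapse.nonlocalEnergy p (ν ε) u (Ω ×ˢ Ωᶜ)) (𝓝[>] 0) (𝓝 0) ∧
    Tendsto (fun ε : ℝ => NonlocalCollapse.nonlocalEnergy p (ν ε) u (Ω ×ˢ Set.univ)) (𝓝[>] 0)
      (𝓝 (ENNReal.ofReal (NonlocalCollapse.sphereMean p e) * ∫⁻ x in Ω, ‖g x‖ₑ ^ p)) ∧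
    Tendsto (fun ε : ℝ => NonlocalCollapse.nonlocalEnergy p (ν ε) u (Ωᶜ ×ˢ Ωᶜ)ᶜ) (𝓝[>] 0)
      (𝓝 (ENNReal.ofReal (NonlocalCollapse.sphereMean p e) * ∫⁻ x in Ω, ‖g x‖ₑ ^ p)) := by
  obtain ⟨hup, g', hg', hgp'⟩ := hu
  rw [Measure.restrict_univ] at hup hgp'
  -- The given gradient agrees almost everywhere with the p-integrable one supplied by membership in
  -- W^{1,p}.
  have hgp : MemLp g (ENNReal.ofReal p) volume := hgp'.ae_eq (hg'.ae_eq hg)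
  have hnull := NonlocalCollapse.volume_frontier_eq_zero hΩ hLip
  have h1 := NonlocalCollapse.tendsto_nonlocalEnergy_prod_compl hp hν hup hgp hg he hΩ hnull
  have h2 := NonlocalCollapse.tendsto_nonlocalEnergy_prod_univ hp hν hup hgp hg he Ω
  refine ⟨h1, h2, ?_⟩
  have hset : (Ωᶜ ×ˢ Ωᶜ)ᶜ = Ω ×ˢ univ ∪ Ωᶜ ×ˢ Ω := by
    ext ⟨x, y⟩
    simp only [mem_compl_iff, mem_prod, mem_union, mem_univ]
    tauto
  have h3 := h2.add h1
  rw [add_zero] at h3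
  -- Squeeze between the energy on Ω × ℝ^d and that energy plus the vanishing cross energy.
  refine tendsto_of_tendsto_of_tendsto_of_le_of_le' h2 h3 ?_ ?_
  · refine Eventually.of_forall fun ε => NonlocalCollapse.nonlocalEnergy_mono ?_
    rw [hset]
    exact subset_union_left
  · filter_upwards [self_mem_nhdsWithin] with ε hε
    rw [hset, NonlocalCollapse.nonlocalEnergy_prod_comm (hν.radial ε hε) u Ω Ωᶜ]
    exact NonlocalCollapse.nonlocalEnergy_union_le _ _
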